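/- Let $n, r, p \ge 0$ be integers, $\mu > 0$, $\ell \ge 0$. Let $\hat f_\tau : \mathbb{R}^n \to \mathbb{R}$ ($1 \le \tau \le p-1$) be $\mu$-strongly convex and twice continuously differentiable, and let $\hat c_\tau : \mathbb{R}^n \times \mathbb{R}^n \times \mathbb{R}^r \to \mathbb{R}$ ($1 \le \tau \le p$) be convex, twice continuously differentiable and $\ell$-strongly smooth, i.e. $\hat c_\tau(v) \le \hat c_\tau(u) + \langle \nabla \hat c_\tau(u), v-u\rangle + \frac{\ell}{2}\|v-u\|^2$ for all $u, v$; all norms are Euclidean. Then for all $\hat x_0, \hat x_p \in \mathbb{R}^n$ and $\hat w = (\hat w_0, \dots, \hat w_{p-1}) \in (\mathbb{R}^r)^p$ the smoothed online convex optimization problem with fixed endpoints has a unique solution \[\hat\psi(\hat x_0, \hat w, \hat x_p) := \operatorname*{argmin}_{\hat x_1, \dots, \hat x_{p-1} \in \mathbb{R}^n} \ \sum_{\tau=1}^{p-1} \hat f_\tau(\hat x_\tau) + \sum_{\tau=1}^{p} \hat c_\tau(\hat x_\tau, \hat x_{\tau-1}, \hat w_{\tau-1}),\] whose components are indexed by $1,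 \dots, p-1$, and for all $(\hat x_0, \hat w, \hat x_p)$, $(\hat x_0', \hat w', \hat x_p')$ and all $1 \le h \le p-1$, \[\|\hat\psi(\hat x_0, \hat w, \hat x_p)_h - \hat\psi(\hat x_0', \hat w', \hat x_p')_h\| \le C_0\left(\lambda_0^{h-1}\|\hat x_0 - \hat x_0'\| + \sum_{\tau=0}^{p-1} \lambda_0^{|h-\tau|-1}\|\hat w_\tau - \hat w_\tau'\| + \lambda_0^{p-h-1}\|\hat x_p - \hat x_p'\|\right),\] where $C_0 = 2\ell/\mu$ and $\lambda_0 = 1 - 2\left(\sqrt{1 + 2\ell/\mu} + 1\right)^{-1}$. (If $\ell = 0$, then $C_0 = 0$ and the right-hand side is read as $0$.) -/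

import Mathlib

/-- `ℝⁿ` with the Euclidean norm. -/
abbrev Euc (n : ℕ) : Type := EuclideanSpace ℝ (Fin n)

/-- `ℝⁿ × ℝⁿ × ℝʳ` with the Euclidean norm of `ℝ^(n + n + r)`, the domain of a switching cost. -/
abbrev SwitchDom (n r : ℕ) : Type := WithLp 2 (Euc n × WithLp 2 (Euc n × Euc r))

/-- The point `(x, x', w)` of `ℝⁿ × ℝⁿ × ℝʳ`. -/
abbrev switchPt {n r : ℕ} (x x' : Euc n) (w : Euc r) : SwitchDom n r :=
  WithLp.toLp 2 (x, WithLp.toLp 2 (x', w))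

/-- A (differentiable) function `g` is `ℓ`-strongly smooth:
`g y ≤ g x + ⟨∇ g x, y - x⟩ + ℓ / 2 * ‖y - x‖ ^ 2` for all `x`, `y`. -/
def StronglySmooth {E : Type*} [NormedAddCommGroup E] [InnerProductSpace ℝ E]
    (ℓ : ℝ) (g : E → ℝ) : Prop :=
  ∀ x y : E, g y ≤ g x + fderiv ℝ g x (y - x) + ℓ / 2 * ‖y - x‖ ^ 2

/-- The full trajectory `x_0, x_1, …, x_p` with endpoints `x0`, `xp` and with the decision
variables `y = (x_1, …, x_{p-1})` in between. -/
def socoTrajectory {n : ℕ} (p : ℕ) (x0 xp : Euc n) (y : Finset.Ico 1 p → Euc n) (τ : ℕ) : Euc n :=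
  if h : τ ∈ Finset.Ico 1 p then y ⟨τ, h⟩ else if τ = 0 then x0 else xp

/-- The objective
`∑_{τ=1}^{p-1} f_τ(x_τ) + ∑_{τ=1}^{p} c_τ(x_τ, x_{τ-1}, w_{τ-1})`,
the second sum being indexed by `τ - 1 ∈ {0, …, p-1}`. -/
def socoCost {n r : ℕ} (p : ℕ) (f : ℕ → Euc n → ℝ) (c : ℕ → SwitchDom n r → ℝ)
    (x0 : Euc n) (w : Fin p → Euc r) (xp : Euc n) (y : Finset.Ico 1 p → Euc n) : ℝ :=
  ∑ τ : Finset.Ico 1 p, f τ (y τ) +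
    ∑ i : Fin p, c (i + 1) (switchPt (socoTrajectory p x0 xp y (i + 1))
      (socoTrajectory p x0 xp y i) (w i))

/-- The set of minimizers (argmin) of the objective over `x_1, …, x_{p-1} ∈ ℝⁿ`. -/
def socoArgmin {n r : ℕ} (p : ℕ) (f : ℕ → Euc n → ℝ) (c : ℕ → SwitchDom n r → ℝ)
    (x0 : Euc n) (w : Fin p → Euc r) (xp : Euc n) : Set (Finset.Ico 1 p → Euc n) :=
  {y | ∀ z, socoCost p f c x0 w xp y ≤ socoCost p f c x0 w xp z}

/-- The constant `C₀ = 2ℓ / μ`. -/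
noncomputable def socoC (μ ℓ : ℝ) : ℝ := 2 * ℓ / μ

/-- The decay rate `λ₀ = 1 - 2 (√(1 + 2ℓ/μ) + 1)⁻¹`. -/
noncomputable def socoRate (μ ℓ : ℝ) : ℝ := 1 - 2 * (√(1 + 2 * ℓ / μ) + 1)⁻¹

/-!
The objective is continuous and strongly convex in the decision variables, so its minimizer exists
and is unique (`StrongConvexOn.existsUnique_forall_le`).

For the sensitivity bound no Hessian is inverted and no derivative of the solution map is taken:
two optimal trajectories are compared directly. Let `δ k` be their displacement at time `k`, and let
`P k`, `Q k` be the differences of the partial gradients of the switching cost between the times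
`k` and `k + 1` with respect to `x_{k+1}` and `x_k`. Optimality and strong monotonicity of `∇ f`
give the node balance `μ ‖δ‖² + ⟪δ, P⟫ + ⟪δ, Q⟫ ≤ 0`, and cocoercivity of the gradient of a convex
`ℓ`-smooth function (`ConvexOn.norm_gradient_sub_sq_le`) gives for every edge
`‖P‖² + ‖Q‖² ≤ ℓ (⟪δ (k + 1), P⟫ + ⟪δ k, Q⟫)`, up to the term `(ℓ / 2 * ‖w k - w' k‖)²` from the
displacement of the input (`dissipativeChain_of_mem_argmin`).

The quantity that decays is the flux `‖α‖² - ℓ ⟪u, α⟫`, where `α` is the force that the edge on the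
source side exerts on a node with displacement `u`. Passing a node and the next edge multiplies it by
at most `λ₀²` (`flux_step`): the difference of the two sides is a sum of two squares plus a multiple
of the node balance, exactly because `ℓ (1 - λ₀)² = 2 μ λ₀`. The flux is nonnegative up to the
fixed endpoint, where it starts as a square, and it dominates `(μ ‖u‖)²` (`chain_decay`). Next to a
source of size `a` it is at most `(ℓ / 2 * a)²`. Hence a perturbation of a single datum moves the
solution at distance `m` by at most `ℓ / (2 μ) * λ₀ ^ m * a`, and the triangle inequality over the
data, changed one at a time, gives the claim.
-/

/-! ### Gradients of convex functions -/

section Convex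

variable {E : Type*} [NormedAddCommGroup E] [InnerProductSpace ℝ E]

/-- First-order lower bound for a strongly convex function (`m = 0` is plain convexity). -/
lemma StrongConvexOn.add_fderiv_add_le {m : ℝ} {g : E → ℝ} (hg : StrongConvexOn Set.univ m g)
    {x : E} (hd : DifferentiableAt ℝ g x) (y : E) :
    g x + fderiv ℝ g x (y - x) + m / 2 * ‖y - x‖ ^ 2 ≤ g y := by
  have hline : HasDerivAt (fun t : ℝ => g (x + t • (y - x))) (fderiv ℝ g x (y - x)) 0 := by
    have h1 : HasDerivAt (fun t : ℝ => x + t • (y - x)) (y - x) 0 := by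
      simpa using ((hasDerivAt_id (0 : ℝ)).smul_const (y - x)).const_add x
    have h2 : HasFDerivAt g (fderiv ℝ g x) (x + (0 : ℝ) • (y - x)) := by
      simpa using hd.hasFDerivAt
    exact h2.comp_hasDerivAt 0 h1
  have hslope := hline.tendsto_slope_zero_right
  have hright : Filter.Tendsto (fun t : ℝ => g y - g x - (1 - t) * (m / 2 * ‖y - x‖ ^ 2))
      (nhdsWithin 0 (Set.Ioi 0)) (nhds (g y - g x - (1 - 0) * (m / 2 * ‖y - x‖ ^ 2))) := by
    apply Filter.Tendsto.mono_left _ nhdsWithin_le_nhds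
    exact Continuous.tendsto (by fun_prop) 0
  have hle := le_of_tendsto_of_tendsto hslope hright (by
    filter_upwards [Ioo_mem_nhdsGT (show (0 : ℝ) < 1 by norm_num)] with t ht
    have h := hg.2 (Set.mem_univ x) (Set.mem_univ y) (sub_nonneg.2 ht.2.le) ht.1.le
      (sub_add_cancel 1 t)
    have hpt : (1 - t) • x + t • y = x + t • (y - x) := by module
    rw [hpt, norm_sub_rev] at h
    simp only [smul_eq_mul, zero_add, zero_smul, add_zero] at h ⊢
    rw [inv_mul_le_iff₀ ht.1]
    linarith)
  linarith

variable [CompleteSpace E]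

/-- The gradient of a strongly convex function is strongly monotone. -/
lemma StrongConvexOn.le_inner_gradient_sub {m : ℝ} {g : E → ℝ}
    (hg : StrongConvexOn Set.univ m g) (hd : Differentiable ℝ g) (x y : E) :
    m * ‖x - y‖ ^ 2 ≤ inner ℝ (gradient g x - gradient g y) (x - y) := by
  have h1 := hg.add_fderiv_add_le (hd x) y
  have h2 := hg.add_fderiv_add_le (hd y) x
  rw [norm_sub_rev y x, ← neg_sub x y, map_neg] at h1
  rw [inner_sub_left, inner_gradient_left, inner_gradient_left]
  linarith

/-- Along the gradient difference `d`, smoothness from above and convexity from below give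
a lower bound on the linearization gap for every step length `t`. -/
lemma ConvexOn.mul_norm_sq_le_of_stronglySmooth {ℓ : ℝ} {g : E → ℝ}
    (hg : ConvexOn ℝ Set.univ g) (hs : StronglySmooth ℓ g) (hd : Differentiable ℝ g)
    (x y : E) (t : ℝ) :
    (t - ℓ / 2 * t ^ 2) * ‖gradient g x - gradient g y‖ ^ 2 ≤
      g x - g y - fderiv ℝ g y (x - y) := by
  set d := gradient g x - gradient g y with hdd
  have hlow := (strongConvexOn_zero.2 hg).add_fderiv_add_le (hd y) (x - t • d)
  have hup := hs x (x - t • d)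
  have e1 : x - t • d - x = -(t • d) := by abel
  have e2 : x - t • d - y = (x - y) - t • d := by abel
  rw [e1, map_neg, map_smul, norm_neg, norm_smul, mul_pow, Real.norm_eq_abs, sq_abs,
    smul_eq_mul] at hup
  rw [e2, map_sub, map_smul, smul_eq_mul] at hlow
  have hinner : fderiv ℝ g x d - fderiv ℝ g y d = ‖d‖ ^ 2 := by
    rw [← inner_gradient_left, ← inner_gradient_left, ← inner_sub_left, ← hdd,
      real_inner_self_eq_norm_sq]
  linear_combination hlow + hup - t * hinner

/-- Baillon–Haddad: the gradient of a convex, strongly smooth function is cocoercive. The form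
without division also covers `ℓ = 0`, where the gradient is constant. -/
lemma ConvexOn.norm_gradient_sub_sq_le {ℓ : ℝ} (hℓ : 0 ≤ ℓ) {g : E → ℝ}
    (hg : ConvexOn ℝ Set.univ g) (hs : StronglySmooth ℓ g) (hd : Differentiable ℝ g) (x y : E) :
    ‖gradient g x - gradient g y‖ ^ 2 ≤
      ℓ * inner ℝ (gradient g x - gradient g y) (x - y) := by
  have key : ∀ t : ℝ, (2 * t - ℓ * t ^ 2) * ‖gradient g x - gradient g y‖ ^ 2 ≤
      inner ℝ (gradient g x - gradient g y) (x - y) := by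
    intro t
    have h1 := hg.mul_norm_sq_le_of_stronglySmooth hs hd x y t
    have h2 := hg.mul_norm_sq_le_of_stronglySmooth hs hd y x t
    rw [norm_sub_rev, ← neg_sub x y, map_neg] at h2
    rw [inner_sub_left, inner_gradient_left, inner_gradient_left]
    linarith
  rcases hℓ.eq_or_lt with rfl | hpos
  · -- With `ℓ = 0` the bound is linear in the step length, which forces the gap to vanish.
    by_contra! hne
    rw [zero_mul] at hne
    have h := key ((inner ℝ (gradient g x - gradient g y) (x - y) + 1) /
      (2 * ‖gradient g x - gradient g y‖ ^ 2))
    have e : ∀ I X : ℝ, 0 < X → (2 * ((I + 1) / (2 * X)) - 0 * ((I + 1) / (2 * X)) ^ 2) * X =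
        I + 1 := fun I X hX => by field_simp; ring
    rw [e _ _ hne] at h
    linarith
  · have h := key (1 / ℓ)
    have e : (2 * (1 / ℓ) - ℓ * (1 / ℓ) ^ 2) = 1 / ℓ := by field_simp; ring
    rw [e, one_div, inv_mul_le_iff₀ hpos] at h
    exact h

end Convex

/-! ### The decay rate -/

section Rate

variable {μ ℓ : ℝ}

lemma one_le_sqrt_one_add (hμ : 0 < μ) (hℓ : 0 ≤ ℓ) : 1 ≤ √(1 + 2 * ℓ / μ) :=
  Real.one_le_sqrt.2 (le_add_of_nonneg_right (by positivity))

lemma socoRate_nonneg (hμ : 0 < μ) (hℓ : 0 ≤ ℓ) : 0 ≤ socoRate μ ℓ := by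
  have h := one_le_sqrt_one_add hμ hℓ
  rw [socoRate, sub_nonneg, ← div_eq_mul_inv, div_le_one (by linarith)]
  linarith

lemma socoRate_pos (hμ : 0 < μ) (hℓ : 0 < ℓ) : 0 < socoRate μ ℓ := by
  have h : 1 < √(1 + 2 * ℓ / μ) :=
    Real.lt_sqrt_of_sq_lt (by rw [one_pow]; exact lt_add_of_pos_right _ (by positivity))
  rw [socoRate, sub_pos, ← div_eq_mul_inv, div_lt_one (by linarith)]
  linarith

lemma socoRate_le_one (μ ℓ : ℝ) : socoRate μ ℓ ≤ 1 :=
  sub_le_self _ (by positivity)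

/-- The rate is the root in `[0, 1)` of `ℓ (1 - λ)² = 2 μ λ`, the characteristic equation of the
scalar chain with node Hessians `μ` and edge Hessians `ℓ / 2 * (x - x')²`. -/
lemma socoRate_quadratic (hμ : 0 < μ) (hℓ : 0 ≤ ℓ) :
    ℓ * (1 - socoRate μ ℓ) ^ 2 = 2 * μ * socoRate μ ℓ := by
  have h := one_le_sqrt_one_add hμ hℓ
  have hsq : √(1 + 2 * ℓ / μ) ^ 2 = 1 + 2 * ℓ / μ := Real.sq_sqrt (by positivity)
  rw [socoRate]
  set s := √(1 + 2 * ℓ / μ)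
  have hs : s + 1 ≠ 0 := by linarith
  have hℓs : ℓ = μ * (s ^ 2 - 1) / 2 := by rw [hsq]; field_simp; ring
  rw [hℓs]
  field_simp
  ring

end Rate

/-! ### Decay along a chain -/

section Chain

variable {E : Type*} [NormedAddCommGroup E] [InnerProductSpace ℝ E] {μ ℓ : ℝ}

/-- One step of the flux decay. A node with displacement `u` receives the force `α` from one edge
and `β` from the other; balance at the node bounds the flux leaving through the second edge by
`λ²` times the flux entering from the first. -/
lemma flux_step (hμ : 0 < μ) (hℓ : 0 ≤ ℓ) {u α β : E}
    (h : μ * ‖u‖ ^ 2 + inner ℝ u α + inner ℝ u β ≤ 0) :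
    ℓ * inner ℝ u β - ‖β‖ ^ 2 ≤ socoRate μ ℓ ^ 2 * (‖α‖ ^ 2 - ℓ * inner ℝ u α) := by
  have hq := socoRate_quadratic hμ hℓ
  have h0 := socoRate_nonneg hμ hℓ
  set q := socoRate μ ℓ
  -- The difference of the two sides is a sum of two squares plus `λ ℓ` times the node slack;
  -- the `‖u‖²` terms cancel by the quadratic equation for the rate.
  have h1 : 0 ≤ ‖q • α + ((1 - q) * ℓ / 2) • u‖ ^ 2 := by positivity
  have h2 : 0 ≤ ‖β - ((1 - q) * ℓ / 2) • u‖ ^ 2 := by positivity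
  rw [norm_add_sq_real, norm_smul, norm_smul, real_inner_smul_left, real_inner_smul_right,
    mul_pow, mul_pow, Real.norm_eq_abs, Real.norm_eq_abs, sq_abs, sq_abs,
    real_inner_comm] at h1
  rw [norm_sub_sq_real, norm_smul, real_inner_smul_right, mul_pow, Real.norm_eq_abs, sq_abs,
    real_inner_comm] at h2
  have h3 := mul_le_mul_of_nonneg_left h (mul_nonneg h0 hℓ)
  linear_combination h1 + h2 + h3 + ‖u‖ ^ 2 * ℓ / 2 * hq

/-- Decay away from a source along a chain of nodes `0, …, N`, the last of them fixed. Node `m`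
has displacement `u m`, and receives the force `α m` from the edge on the source side and `β m` from
the edge to node `m + 1`. -/
lemma chain_decay (hμ : 0 < μ) (hℓ : 0 ≤ ℓ) {N : ℕ} {u α β : ℕ → E}
    (hnode : ∀ m < N, μ * ‖u m‖ ^ 2 + inner ℝ (u m) (α m) + inner ℝ (u m) (β m) ≤ 0)
    (hedge : ∀ m < N, ‖β m‖ ^ 2 + ‖α (m + 1)‖ ^ 2 ≤
      ℓ * (inner ℝ (u m) (β m) + inner ℝ (u (m + 1)) (α (m + 1))))
    (hend : u N = 0) :
    0 ≤ ‖α 0‖ ^ 2 - ℓ * inner ℝ (u 0) (α 0) ∧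
      ∀ m < N, (μ * ‖u m‖) ^ 2 ≤
        (socoRate μ ℓ ^ m) ^ 2 * (‖α 0‖ ^ 2 - ℓ * inner ℝ (u 0) (α 0)) := by
  -- The flux from node `m + 1` onwards is at most what leaves node `m`.
  have hleave : ∀ m < N, ‖α (m + 1)‖ ^ 2 - ℓ * inner ℝ (u (m + 1)) (α (m + 1)) ≤
      ℓ * inner ℝ (u m) (β m) - ‖β m‖ ^ 2 := fun m hm => by
    linarith [hedge m hm]
  -- If the flux leaving node `m` is nonnegative, then node `m` does work on the edge behind it.
  have hforce : ∀ m < N, 0 ≤ ‖α (m + 1)‖ ^ 2 - ℓ * inner ℝ (u (m + 1)) (α (m + 1)) →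
      μ * ‖u m‖ ^ 2 ≤ - inner ℝ (u m) (α m) := fun m hm h0 => by
    have h1 : ‖β m‖ ^ 2 ≤ ℓ * inner ℝ (u m) (β m) := by linarith [hleave m hm]
    have h2 : 0 ≤ inner ℝ (u m) (β m) := by
      rcases hℓ.eq_or_lt with rfl | hpos
      · have : β m = 0 := by
          rw [zero_mul] at h1
          exact norm_eq_zero.1 (pow_eq_zero_iff two_ne_zero |>.1 (le_antisymm h1 (sq_nonneg _)))
        rw [this, inner_zero_right]
      · exact nonneg_of_mul_nonneg_right ((sq_nonneg _).trans h1) hpos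
    linarith [hnode m hm]
  have hpos : ∀ m ≤ N, 0 ≤ ‖α m‖ ^ 2 - ℓ * inner ℝ (u m) (α m) := by
    intro m hm
    induction hm using Nat.decreasingInduction with
    | self => rw [hend, inner_zero_left, mul_zero, sub_zero]; positivity
    | of_succ k hk ih =>
      have h1 : 0 ≤ ℓ * -inner ℝ (u k) (α k) :=
        mul_nonneg hℓ ((by positivity : 0 ≤ μ * ‖u k‖ ^ 2).trans (hforce k hk ih))
      have h2 : 0 ≤ ‖α k‖ ^ 2 := by positivity
      linarith
  have hdecay : ∀ m ≤ N, ‖α m‖ ^ 2 - ℓ * inner ℝ (u m) (α m) ≤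
      (socoRate μ ℓ ^ m) ^ 2 * (‖α 0‖ ^ 2 - ℓ * inner ℝ (u 0) (α 0)) := by
    intro m
    induction m with
    | zero => intro _; simp
    | succ k ih =>
      intro hk
      calc ‖α (k + 1)‖ ^ 2 - ℓ * inner ℝ (u (k + 1)) (α (k + 1))
          ≤ socoRate μ ℓ ^ 2 * (‖α k‖ ^ 2 - ℓ * inner ℝ (u k) (α k)) :=
            (hleave k hk).trans (flux_step hμ hℓ (hnode k hk))
        _ ≤ socoRate μ ℓ ^ 2 * ((socoRate μ ℓ ^ k) ^ 2 *
              (‖α 0‖ ^ 2 - ℓ * inner ℝ (u 0) (α 0))) := by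
            gcongr
            exact ih (Nat.le_of_succ_le hk)
        _ = _ := by ring
  refine ⟨hpos 0 (Nat.zero_le N), fun m hm => le_trans ?_ (hdecay m hm.le)⟩
  have h := hforce m hm (hpos (m + 1) hm)
  have hwork : 0 ≤ ℓ * -inner ℝ (u m) (α m) :=
    mul_nonneg hℓ ((by positivity : 0 ≤ μ * ‖u m‖ ^ 2).trans h)
  have hα : μ * ‖u m‖ ≤ ‖α m‖ := by
    have hcs : -inner ℝ (u m) (α m) ≤ ‖u m‖ * ‖α m‖ :=
      (neg_le_abs _).trans (abs_real_inner_le_norm _ _)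
    rcases (norm_nonneg (u m)).eq_or_lt with h0 | h0
    · rw [← h0, mul_zero]; exact norm_nonneg _
    · refine le_of_mul_le_mul_left ?_ h0
      linarith
  have hα2 := pow_le_pow_left₀ (by positivity) hα 2
  linarith

lemma le_of_sq_le_sq_mul {a q b F : ℝ} (hq : 0 ≤ q) (hb : 0 ≤ b) (h : a ^ 2 ≤ q ^ 2 * F)
    (hF : F ≤ b ^ 2) : a ≤ q * b := by
  refine le_of_sq_le_sq ?_ (by positivity)
  rw [mul_pow]
  exact h.trans (mul_le_mul_of_nonneg_left hF (by positivity))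

/-- Young's inequality, in the form that turns the work of an endpoint into a source. -/
lemma mul_inner_sub_norm_sq_le (ℓ : ℝ) (x g : E) :
    ℓ * inner ℝ x g - ‖g‖ ^ 2 ≤ (ℓ / 2 * ‖x‖) ^ 2 := by
  have h : 0 ≤ ‖(ℓ / 2) • x - g‖ ^ 2 := by positivity
  rw [norm_sub_sq_real, norm_smul, real_inner_smul_left, mul_pow, Real.norm_eq_abs, sq_abs] at h
  rw [mul_pow]
  linarith

/-- Displacements `δ 0, …, δ p` of a chain, with the forces `P k` and `Q k`, in the sign of
the gradient of the energy, of the edge between nodes `k` and `k + 1` at node `k + 1` and at node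
`k`. The interior nodes are in balance,
and the edges are dissipative up to the squares of the sources `s k`. -/
structure DissipativeChain (μ ℓ : ℝ) (p : ℕ) (δ P Q : ℕ → E) (s : ℕ → ℝ) : Prop where
  node : ∀ k, k + 1 < p → μ * ‖δ (k + 1)‖ ^ 2 + inner ℝ (δ (k + 1)) (P k) +
    inner ℝ (δ (k + 1)) (Q (k + 1)) ≤ 0
  edge : ∀ k < p, ‖P k‖ ^ 2 + ‖Q k‖ ^ 2 ≤
    ℓ * (inner ℝ (δ (k + 1)) (P k) + inner ℝ (δ k) (Q k)) + s k ^ 2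

namespace DissipativeChain

variable {p : ℕ} {δ P Q : ℕ → E} {s : ℕ → ℝ}

/-- Decay to the right of edge `k` when there is no source there. -/
lemma right_decay (hμ : 0 < μ) (hℓ : 0 ≤ ℓ) (C : DissipativeChain μ ℓ p δ P Q s) {k : ℕ}
    (hk : k < p) (hs : ∀ j, k < j → j < p → s j = 0) (hp : δ p = 0) :
    0 ≤ ‖P k‖ ^ 2 - ℓ * inner ℝ (δ (k + 1)) (P k) ∧ ∀ h, k < h → h < p →
      (μ * ‖δ h‖) ^ 2 ≤ (socoRate μ ℓ ^ (h - (k + 1))) ^ 2 *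
        (‖P k‖ ^ 2 - ℓ * inner ℝ (δ (k + 1)) (P k)) := by
  have H := chain_decay (N := p - (k + 1)) (u := fun m => δ (k + 1 + m))
    (α := fun m => P (k + m)) (β := fun m => Q (k + 1 + m)) hμ hℓ
    (fun m hm => by
      have := C.node (k + m) (by omega)
      rwa [show k + m + 1 = k + 1 + m by omega] at this)
    (fun m hm => by
      have := C.edge (k + 1 + m) (by omega)
      rw [hs (k + 1 + m) (by omega) (by omega)] at this
      rw [show k + 1 + (m + 1) = k + 1 + m + 1 by omega,
        show k + (m + 1) = k + 1 + m by omega]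
      linarith)
    (by rwa [show k + 1 + (p - (k + 1)) = p by omega])
  refine ⟨H.1, fun h hkh hhp => ?_⟩
  have := H.2 (h - (k + 1)) (by omega)
  rwa [show k + 1 + (h - (k + 1)) = h by omega] at this

/-- Decay to the left of edge `k` when there is no source there. -/
lemma left_decay (hμ : 0 < μ) (hℓ : 0 ≤ ℓ) (C : DissipativeChain μ ℓ p δ P Q s) {k : ℕ}
    (hk : k < p) (hs : ∀ j < k, s j = 0) (h0 : δ 0 = 0) :
    0 ≤ ‖Q k‖ ^ 2 - ℓ * inner ℝ (δ k) (Q k) ∧ ∀ h, 1 ≤ h → h ≤ k →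
      (μ * ‖δ h‖) ^ 2 ≤ (socoRate μ ℓ ^ (k - h)) ^ 2 *
        (‖Q k‖ ^ 2 - ℓ * inner ℝ (δ k) (Q k)) := by
  have H := chain_decay (N := k) (u := fun m => δ (k - m))
    (α := fun m => Q (k - m)) (β := fun m => P (k - (m + 1))) hμ hℓ
    (fun m hm => by
      have := C.node (k - (m + 1)) (by omega)
      rw [show k - (m + 1) + 1 = k - m by omega] at this
      linarith)
    (fun m hm => by
      have := C.edge (k - (m + 1)) (by omega)
      rw [hs (k - (m + 1)) (by omega), show k - (m + 1) + 1 = k - m by omega] at this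
      linarith)
    (by rwa [Nat.sub_self])
  refine ⟨H.1, fun h h1 hhk => ?_⟩
  have := H.2 (k - h) (by omega)
  rwa [show k - (k - h) = h by omega] at this

/-- Response to a displacement of the left endpoint. -/
lemma le_of_left_endpoint (hμ : 0 < μ) (hℓ : 0 ≤ ℓ) (C : DissipativeChain μ ℓ p δ P Q s)
    (hs : ∀ j < p, s j = 0) (hp : δ p = 0) {h : ℕ} (h1 : 1 ≤ h) (hhp : h < p) :
    μ * ‖δ h‖ ≤ socoRate μ ℓ ^ (h - 1) * (ℓ / 2 * ‖δ 0‖) := by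
  have hd := (C.right_decay hμ hℓ (k := 0) (by omega) (fun j _ hj => hs j hj) hp).2 h h1 hhp
  refine le_of_sq_le_sq_mul (pow_nonneg (socoRate_nonneg hμ hℓ) _) (by positivity) hd ?_
  have he := C.edge 0 (by omega)
  rw [hs 0 (by omega)] at he
  have hy := mul_inner_sub_norm_sq_le ℓ (δ 0) (Q 0)
  linarith

/-- Response to a displacement of the right endpoint. -/
lemma le_of_right_endpoint (hμ : 0 < μ) (hℓ : 0 ≤ ℓ) (C : DissipativeChain μ ℓ p δ P Q s)
    (hs : ∀ j < p, s j = 0) (h0 : δ 0 = 0) {h : ℕ} (h1 : 1 ≤ h) (hhp : h < p) :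
    μ * ‖δ h‖ ≤ socoRate μ ℓ ^ (p - 1 - h) * (ℓ / 2 * ‖δ p‖) := by
  have hd := (C.left_decay hμ hℓ (k := p - 1) (by omega) (fun j hj => hs j (by omega)) h0).2 h h1
    (by omega)
  refine le_of_sq_le_sq_mul (pow_nonneg (socoRate_nonneg hμ hℓ) _) (by positivity) hd ?_
  have he := C.edge (p - 1) (by omega)
  rw [hs (p - 1) (by omega), Nat.sub_add_cancel (by omega)] at he
  have hy := mul_inner_sub_norm_sq_le ℓ (δ p) (P (p - 1))
  linarith

/-- Response to a source on the single edge `k`. The fluxes on its two sides are nonnegative, so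
each of them is bounded by the source. -/
lemma le_of_source (hμ : 0 < μ) (hℓ : 0 ≤ ℓ) (C : DissipativeChain μ ℓ p δ P Q s) {k : ℕ}
    (hk : k < p) (hs : ∀ j < p, j ≠ k → s j = 0) (hsk : 0 ≤ s k) (h0 : δ 0 = 0) (hp : δ p = 0)
    {h : ℕ} (h1 : 1 ≤ h) (hhp : h < p) :
    (k < h → μ * ‖δ h‖ ≤ socoRate μ ℓ ^ (h - (k + 1)) * s k) ∧
      (h ≤ k → μ * ‖δ h‖ ≤ socoRate μ ℓ ^ (k - h) * s k) := by
  obtain ⟨hR0, hR⟩ := C.right_decay hμ hℓ hk (fun j hj hj' => hs j hj' hj.ne') hp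
  obtain ⟨hL0, hL⟩ := C.left_decay hμ hℓ hk (fun j hj => hs j (hj.trans hk) hj.ne) h0
  have he := C.edge k hk
  have hq := socoRate_nonneg hμ hℓ
  exact ⟨fun hkh => le_of_sq_le_sq_mul (pow_nonneg hq _) hsk (hR h hkh hhp) (by linarith),
    fun hhk => le_of_sq_le_sq_mul (pow_nonneg hq _) hsk (hL h h1 hhk) (by linarith)⟩

end DissipativeChain

end Chain

/-! ### Existence and uniqueness of the minimizer -/

/-- A continuous strongly convex function on a finite-dimensional space has a unique minimizer:
if `g z < g 0` with `‖z‖` large, then strong convexity would push `g (z / ‖z‖)` below the minimum of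
`g` on the unit ball. -/
lemma StrongConvexOn.existsUnique_forall_le {V : Type*} [NormedAddCommGroup V] [NormedSpace ℝ V]
    [FiniteDimensional ℝ V] {m : ℝ} (hm : 0 < m) {g : V → ℝ} (hg : StrongConvexOn Set.univ m g)
    (hc : Continuous g) : ∃! x, ∀ z, g x ≤ g z := by
  have := FiniteDimensional.proper_real V
  obtain ⟨b, hb, hbmin⟩ := (isCompact_closedBall (0 : V) 1).exists_isMinOn
    ⟨0, by simp⟩ hc.continuousOn
  have hb0 : g b ≤ g 0 := hbmin (by simp)
  have hfar : ∀ᶠ z in Filter.cocompact V, g 0 ≤ g z := by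
    filter_upwards [tendsto_norm_cocompact_atTop.eventually_gt_atTop
      (1 + 2 * (g 0 - g b) / m)] with z hz
    by_contra! hlt
    have hR : 1 < ‖z‖ := lt_of_le_of_lt
      (le_add_of_nonneg_right (div_nonneg (by linarith) hm.le)) hz
    have hR0 : 0 < ‖z‖ := by linarith
    have h := hg.2 (Set.mem_univ z) (Set.mem_univ 0) (inv_nonneg.2 hR0.le)
      (sub_nonneg.2 (inv_le_one_of_one_le₀ hR.le)) (add_sub_cancel _ 1)
    have hball : g b ≤ g (‖z‖⁻¹ • z + (1 - ‖z‖⁻¹) • (0 : V)) :=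
      hbmin (by simp [norm_smul, hR0.ne'])
    have hz0 : ‖z‖⁻¹ * g z ≤ ‖z‖⁻¹ * g 0 := by gcongr
    have hmod : ‖z‖⁻¹ * (1 - ‖z‖⁻¹) * (m / 2 * ‖z - 0‖ ^ 2) = (‖z‖ - 1) * m / 2 := by
      rw [sub_zero]; field_simp
    have hz' : 2 * (g 0 - g b) < (‖z‖ - 1) * m := by
      rw [← div_lt_iff₀ hm]; linarith
    rw [hmod, smul_eq_mul, smul_eq_mul] at h
    linarith
  obtain ⟨x, hx⟩ := hc.exists_forall_le' 0 hfar
  refine ⟨x, hx, fun y hy => ?_⟩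
  exact (hg.strictConvexOn hm).eq_of_isMinOn (fun z _ => hy z) (fun z _ => hx z)
    (Set.mem_univ y) (Set.mem_univ x)

section Problem

variable {n r p : ℕ} {μ ℓ : ℝ} {f : ℕ → Euc n → ℝ} {c : ℕ → SwitchDom n r → ℝ}

lemma socoTrajectory_zero (x0 xp : Euc n) (y : Finset.Ico 1 p → Euc n) :
    socoTrajectory p x0 xp y 0 = x0 := by
  simp [socoTrajectory]

lemma socoTrajectory_last (hp : p ≠ 0) (x0 xp : Euc n) (y : Finset.Ico 1 p → Euc n) :
    socoTrajectory p x0 xp y p = xp := by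
  simp [socoTrajectory, hp]

lemma socoTrajectory_coe (x0 xp : Euc n) (y : Finset.Ico 1 p → Euc n) (h : Finset.Ico 1 p) :
    socoTrajectory p x0 xp y h = y h := by
  rw [socoTrajectory, dif_pos h.2]

lemma socoTrajectory_add_smul (x0 xp : Euc n) (y e : Finset.Ico 1 p → Euc n) (t : ℝ) (τ : ℕ) :
    socoTrajectory p x0 xp (y + t • e) τ =
      socoTrajectory p x0 xp y τ + t • socoTrajectory p 0 0 e τ := by
  unfold socoTrajectory
  split_ifs <;> simp

lemma socoTrajectory_convexComb (x0 xp : Euc n) (y z : Finset.Ico 1 p → Euc n) {a b : ℝ}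
    (hab : a + b = 1) (τ : ℕ) :
    socoTrajectory p x0 xp (a • y + b • z) τ =
      a • socoTrajectory p x0 xp y τ + b • socoTrajectory p x0 xp z τ := by
  unfold socoTrajectory
  split_ifs
  · rfl
  · rw [← add_smul, hab, one_smul]
  · rw [← add_smul, hab, one_smul]

lemma socoTrajectory_single [DecidableEq (Finset.Ico 1 p)] (h : Finset.Ico 1 p) (v : Euc n)
    (τ : ℕ) : socoTrajectory p 0 0 (Pi.single h v) τ = if τ = h then v else 0 := by
  unfold socoTrajectory
  split_ifs with h1 h2 h2 h3 h3
  · subst h2; simp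
  · rw [Pi.single_eq_of_ne]; exact fun h3 => h2 (congrArg Subtype.val h3)
  all_goals first | rfl | exact absurd (by rw [‹τ = h›]; exact h.2) h1

@[fun_prop]
lemma continuous_socoTrajectory (x0 xp : Euc n) (τ : ℕ) :
    Continuous fun y : Finset.Ico 1 p → Euc n => socoTrajectory p x0 xp y τ := by
  unfold socoTrajectory
  split_ifs <;> fun_prop

/-- The norm on the space of decision variables is the supremum norm, which the Euclidean norm
dominates; so strong convexity in the decision variables holds with the same modulus. -/
lemma strongConvexOn_socoCost (hμ : 0 ≤ μ)
    (hf : ∀ τ ∈ Finset.Ico 1 p, StrongConvexOn Set.univ μ (f τ))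
    (hc : ∀ τ ∈ Finset.Icc 1 p, ConvexOn ℝ Set.univ (c τ))
    (x0 : Euc n) (w : Fin p → Euc r) (xp : Euc n) :
    StrongConvexOn Set.univ μ (socoCost p f c x0 w xp) := by
  refine ⟨convex_univ, fun y _ z _ a b ha hb hab => ?_⟩
  have hnode : ∑ τ : Finset.Ico 1 p, f τ ((a • y + b • z) τ) ≤
      ∑ τ : Finset.Ico 1 p, (a * f τ (y τ) + b * f τ (z τ)
        - a * b * (μ / 2 * ‖y τ - z τ‖ ^ 2)) :=
    Finset.sum_le_sum fun τ _ =>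
      (hf τ τ.2).2 (Set.mem_univ (y τ)) (Set.mem_univ (z τ)) ha hb hab
  have hedge : ∑ i : Fin p, c (i + 1) (switchPt (socoTrajectory p x0 xp (a • y + b • z) (i + 1))
      (socoTrajectory p x0 xp (a • y + b • z) i) (w i)) ≤
      ∑ i : Fin p, (a * c (i + 1) (switchPt (socoTrajectory p x0 xp y (i + 1))
      (socoTrajectory p x0 xp y i) (w i)) + b * c (i + 1) (switchPt
      (socoTrajectory p x0 xp z (i + 1)) (socoTrajectory p x0 xp z i) (w i))) := by
    refine Finset.sum_le_sum fun i _ => ?_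
    have h := (hc (i + 1) (by simp [Nat.succ_le_of_lt i.2])).2
      (Set.mem_univ (switchPt (socoTrajectory p x0 xp y (i + 1)) (socoTrajectory p x0 xp y i) (w i)))
      (Set.mem_univ (switchPt (socoTrajectory p x0 xp z (i + 1)) (socoTrajectory p x0 xp z i) (w i)))
      ha hb hab
    refine le_of_eq_of_le (congrArg (c (i + 1)) ?_) h
    rw [socoTrajectory_convexComb _ _ _ _ hab, socoTrajectory_convexComb _ _ _ _ hab]
    conv_lhs => rw [← one_smul ℝ (w i), ← hab, add_smul]
    rfl
  have hnorm : ‖y - z‖ ^ 2 ≤ ∑ τ : Finset.Ico 1 p, ‖y τ - z τ‖ ^ 2 := by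
    rw [← Real.le_sqrt (norm_nonneg _) (by positivity)]
    refine (pi_norm_le_iff_of_nonneg (Real.sqrt_nonneg _)).2 fun τ => ?_
    refine Real.le_sqrt_of_sq_le ?_
    exact Finset.single_le_sum (f := fun τ => ‖y τ - z τ‖ ^ 2) (fun τ _ => sq_nonneg _)
      (Finset.mem_univ τ)
  have hmod := mul_le_mul_of_nonneg_left hnorm
    (show 0 ≤ a * b * (μ / 2) by positivity)
  simp only [socoCost, smul_eq_mul]
  rw [Finset.sum_sub_distrib, Finset.sum_add_distrib, ← Finset.mul_sum, ← Finset.mul_sum,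
    ← Finset.mul_sum, ← Finset.mul_sum] at hnode
  rw [Finset.sum_add_distrib, ← Finset.mul_sum, ← Finset.mul_sum] at hedge
  linarith

lemma continuous_socoCost (hf : ∀ τ ∈ Finset.Ico 1 p, Continuous (f τ))
    (hc : ∀ τ ∈ Finset.Icc 1 p, Continuous (c τ))
    (x0 : Euc n) (w : Fin p → Euc r) (xp : Euc n) :
    Continuous (socoCost p f c x0 w xp) := by
  unfold socoCost
  refine (continuous_finsetSum _ fun (τ : Finset.Ico 1 p) _ => (hf τ τ.2).comp (continuous_apply τ)).add
    (continuous_finsetSum _ fun (i : Fin p) _ =>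
      (hc (i + 1) (by simp [Nat.succ_le_of_lt i.2])).comp ?_)
  unfold switchPt
  fun_prop

/-! ### Optimality conditions and the chain of displacements -/

lemma inner_switchPt (g : SwitchDom n r) (a b : Euc n) (v : Euc r) :
    inner ℝ g (switchPt a b v) =
      inner ℝ a g.fst + inner ℝ b g.snd.fst + inner ℝ v g.snd.snd := by
  simp only [switchPt, WithLp.prod_inner_apply, real_inner_comm]
  rw [add_assoc]
  rfl

lemma norm_sq_switchDom (g : SwitchDom n r) :
    ‖g‖ ^ 2 = ‖g.fst‖ ^ 2 + ‖g.snd.fst‖ ^ 2 + ‖g.snd.snd‖ ^ 2 := by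
  rw [WithLp.prod_norm_sq_eq_of_L2, WithLp.prod_norm_sq_eq_of_L2]
  ring

/-- The gradient of the switching cost between the times `k` and `k + 1` along a trajectory. For
`k ≥ p`, where there is no input, the input is taken to be `0`. -/
noncomputable def switchGrad (p : ℕ) (c : ℕ → SwitchDom n r → ℝ) (x0 : Euc n) (w : Fin p → Euc r)
    (xp : Euc n) (y : Finset.Ico 1 p → Euc n) (k : ℕ) : SwitchDom n r :=
  gradient (c (k + 1)) (switchPt (socoTrajectory p x0 xp y (k + 1)) (socoTrajectory p x0 xp y k)
    (if h : k < p then w ⟨k, h⟩ else 0))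

/-- Vanishing of the directional derivatives of the objective at a minimizer. -/
lemma sum_inner_gradient_eq_zero (hf : ∀ τ ∈ Finset.Ico 1 p, Differentiable ℝ (f τ))
    (hc : ∀ τ ∈ Finset.Icc 1 p, Differentiable ℝ (c τ))
    {x0 : Euc n} {w : Fin p → Euc r} {xp : Euc n} {y : Finset.Ico 1 p → Euc n}
    (hy : y ∈ socoArgmin p f c x0 w xp) (e : Finset.Ico 1 p → Euc n) :
    ∑ τ : Finset.Ico 1 p, inner ℝ (gradient (f τ) (y τ)) (e τ) +
      ∑ i : Fin p, inner ℝ (switchGrad p c x0 w xp y i)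
        (switchPt (socoTrajectory p 0 0 e (i + 1)) (socoTrajectory p 0 0 e i) 0) = 0 := by
  have hline : ∀ {V : Type} [NormedAddCommGroup V] [InnerProductSpace ℝ V] [CompleteSpace V]
      {g : V → ℝ} (_ : Differentiable ℝ g) (x v : V),
      HasDerivAt (fun t : ℝ => g (x + t • v)) (inner ℝ (gradient g x) v) 0 := by
    intro V _ _ _ g hg x v
    have h1 : HasDerivAt (fun t : ℝ => x + t • v) v 0 := by
      simpa using ((hasDerivAt_id (0 : ℝ)).smul_const v).const_add x
    have h2 : HasFDerivAt g (fderiv ℝ g x) (x + (0 : ℝ) • v) := by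
      simpa using (hg x).hasFDerivAt
    rw [inner_gradient_left]
    exact h2.comp_hasDerivAt 0 h1
  have hderiv : HasDerivAt (fun t : ℝ => socoCost p f c x0 w xp (y + t • e))
      (∑ τ : Finset.Ico 1 p, inner ℝ (gradient (f τ) (y τ)) (e τ) +
      ∑ i : Fin p, inner ℝ (switchGrad p c x0 w xp y i)
        (switchPt (socoTrajectory p 0 0 e (i + 1)) (socoTrajectory p 0 0 e i) 0)) 0 := by
    unfold socoCost
    refine (HasDerivAt.fun_sum fun (τ : Finset.Ico 1 p) _ => hline (hf τ τ.2) (y τ) (e τ)).add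
      (HasDerivAt.fun_sum fun (i : Fin p) _ => ?_)
    have h := hline (hc (i + 1) (by simp [Nat.succ_le_of_lt i.2]))
      (switchPt (socoTrajectory p x0 xp y (i + 1)) (socoTrajectory p x0 xp y i) (w i))
      (switchPt (socoTrajectory p 0 0 e (i + 1)) (socoTrajectory p 0 0 e i) 0)
    rw [switchGrad, dif_pos i.2]
    refine h.congr_of_eventuallyEq (Filter.Eventually.of_forall fun t =>
      congrArg (c (i + 1)) ?_)
    rw [socoTrajectory_add_smul, socoTrajectory_add_smul]
    conv_lhs => rw [← add_zero (w i), ← smul_zero (A := Euc r) t]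
    rfl
  refine IsLocalMin.hasDerivAt_eq_zero (Filter.Eventually.of_forall fun t => ?_) hderiv
  simpa using hy (y + t • e)

/-- Balance of forces at node `k + 1`. -/
lemma inner_node_eq_zero (hf : ∀ τ ∈ Finset.Ico 1 p, Differentiable ℝ (f τ))
    (hc : ∀ τ ∈ Finset.Icc 1 p, Differentiable ℝ (c τ))
    {x0 : Euc n} {w : Fin p → Euc r} {xp : Euc n} {y : Finset.Ico 1 p → Euc n}
    (hy : y ∈ socoArgmin p f c x0 w xp) {k : ℕ} (hk : k + 1 < p) (v : Euc n) :
    inner ℝ (gradient (f (k + 1)) (socoTrajectory p x0 xp y (k + 1))) v +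
      inner ℝ v (switchGrad p c x0 w xp y k).fst +
      inner ℝ v (switchGrad p c x0 w xp y (k + 1)).snd.fst = 0 := by
  classical
  have hmem : k + 1 ∈ Finset.Ico 1 p := by simp [hk]
  have h := sum_inner_gradient_eq_zero hf hc hy (Pi.single ⟨k + 1, hmem⟩ v)
  have hy' : socoTrajectory p x0 xp y (k + 1) = y ⟨k + 1, hmem⟩ :=
    socoTrajectory_coe x0 xp y ⟨k + 1, hmem⟩
  rw [Finset.sum_eq_single ⟨k + 1, hmem⟩
    (fun τ _ hτ => by rw [Pi.single_eq_of_ne hτ, inner_zero_right]) (by simp),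
    Pi.single_eq_same] at h
  simp only [inner_switchPt, socoTrajectory_single, inner_zero_left, add_zero] at h
  rw [Fin.sum_univ_eq_sum_range (fun i => inner ℝ (if i + 1 = k + 1 then v else 0)
    (switchGrad p c x0 w xp y i).fst + inner ℝ (if i = k + 1 then v else 0)
    (switchGrad p c x0 w xp y i).snd.fst) p, Finset.sum_add_distrib,
    Finset.sum_eq_single_of_mem k (Finset.mem_range.2 (by omega))
      (fun i _ hi => by rw [if_neg (by omega), inner_zero_left]),
    Finset.sum_eq_single_of_mem (k + 1) (Finset.mem_range.2 hk)
      (fun i _ hi => by rw [if_neg hi, inner_zero_left]), if_pos rfl] at h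
  rw [hy', add_assoc]
  exact h

/-- The displacement between two optimal trajectories is a dissipative chain: the nodes balance by
optimality and strong monotonicity of `∇ f`, and the edges dissipate by cocoercivity of `∇ c`, with
the displacement of the input as source. -/
lemma dissipativeChain_of_mem_argmin (hℓ : 0 ≤ ℓ)
    (hf_convex : ∀ τ ∈ Finset.Ico 1 p, StrongConvexOn Set.univ μ (f τ))
    (hf : ∀ τ ∈ Finset.Ico 1 p, Differentiable ℝ (f τ))
    (hc_convex : ∀ τ ∈ Finset.Icc 1 p, ConvexOn ℝ Set.univ (c τ))
    (hc_smooth : ∀ τ ∈ Finset.Icc 1 p, StronglySmooth ℓ (c τ))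
    (hc : ∀ τ ∈ Finset.Icc 1 p, Differentiable ℝ (c τ))
    {x0 x0' : Euc n} {w w' : Fin p → Euc r} {xp xp' : Euc n} {y y' : Finset.Ico 1 p → Euc n}
    (hy : y ∈ socoArgmin p f c x0 w xp) (hy' : y' ∈ socoArgmin p f c x0' w' xp') :
    DissipativeChain μ ℓ p
      (fun k => socoTrajectory p x0 xp y k - socoTrajectory p x0' xp' y' k)
      (fun k => (switchGrad p c x0 w xp y k - switchGrad p c x0' w' xp' y' k).fst)
      (fun k => (switchGrad p c x0 w xp y k - switchGrad p c x0' w' xp' y' k).snd.fst)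
      (fun k => ℓ / 2 * ‖(if h : k < p then w ⟨k, h⟩ else 0) -
        (if h : k < p then w' ⟨k, h⟩ else 0)‖) where
  node k hk := by
    have h1 := inner_node_eq_zero hf hc hy hk
      (socoTrajectory p x0 xp y (k + 1) - socoTrajectory p x0' xp' y' (k + 1))
    have h2 := inner_node_eq_zero hf hc hy' hk
      (socoTrajectory p x0 xp y (k + 1) - socoTrajectory p x0' xp' y' (k + 1))
    have hmem : k + 1 ∈ Finset.Ico 1 p := by simp [hk]
    have h3 := (hf_convex _ hmem).le_inner_gradient_sub (hf _ hmem)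
      (socoTrajectory p x0 xp y (k + 1)) (socoTrajectory p x0' xp' y' (k + 1))
    rw [inner_sub_left] at h3
    simp only [WithLp.sub_fst, WithLp.sub_snd]
    rw [inner_sub_right _ (switchGrad p c x0 w xp y k).fst,
      inner_sub_right _ (switchGrad p c x0 w xp y (k + 1)).snd.fst]
    linarith
  edge k hk := by
    have hmem : k + 1 ∈ Finset.Icc 1 p := by simp [Nat.succ_le_of_lt hk]
    have h := (hc_convex _ hmem).norm_gradient_sub_sq_le hℓ (hc_smooth _ hmem) (hc _ hmem)
      (switchPt (socoTrajectory p x0 xp y (k + 1)) (socoTrajectory p x0 xp y k)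
        (if h : k < p then w ⟨k, h⟩ else 0))
      (switchPt (socoTrajectory p x0' xp' y' (k + 1)) (socoTrajectory p x0' xp' y' k)
        (if h : k < p then w' ⟨k, h⟩ else 0))
    have hsub : ∀ (a b a' b' : Euc n) (v v' : Euc r),
        switchPt a b v - switchPt a' b' v' = switchPt (a - a') (b - b') (v - v') :=
      fun _ _ _ _ _ _ => rfl
    rw [hsub (socoTrajectory p x0 xp y (k + 1)), inner_switchPt, norm_sq_switchDom] at h
    have hyoung := mul_inner_sub_norm_sq_le ℓ
      ((if h : k < p then w ⟨k, h⟩ else 0) - (if h : k < p then w' ⟨k, h⟩ else 0))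
      (switchGrad p c x0 w xp y k - switchGrad p c x0' w' xp' y' k).snd.snd
    unfold switchGrad at hyoung ⊢
    linarith

end Problem

/-! ### From single perturbations to the full bound -/

/-- A function of several variables that is Lipschitz in each variable separately changes by at
most the sum of the single changes. -/
lemma norm_sub_le_sum_of_update {ι V W : Type*} [Fintype ι] [DecidableEq ι]
    [NormedAddCommGroup V] [NormedAddCommGroup W] {F : (ι → V) → W} {K : ι → ℝ}
    (h : ∀ w i v, ‖F w - F (Function.update w i v)‖ ≤ K i * ‖w i - v‖) (w w' : ι → V) :
    ‖F w - F w'‖ ≤ ∑ i, K i * ‖w i - w' i‖ := by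
  have key : ∀ s : Finset ι, ‖F w - F (s.piecewise w' w)‖ ≤ ∑ i ∈ s, K i * ‖w i - w' i‖ := by
    intro s
    induction s using Finset.induction_on with
    | empty => simp
    | insert j s hj ih =>
      have h1 := h (s.piecewise w' w) j (w' j)
      rw [Finset.piecewise_eq_of_notMem _ _ _ hj] at h1
      rw [Finset.sum_insert hj, Finset.piecewise_insert, add_comm]
      exact (norm_sub_le_norm_sub_add_norm_sub _ _ _).trans (add_le_add ih h1)
  simpa using key Finset.univ

/-- The exponent may be lowered to any integer: for `ℓ = 0` both sides vanish, whatever the value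
of a negative power of `socoRate μ 0 = 0`. -/
lemma le_socoC_mul_zpow {μ ℓ : ℝ} (hμ : 0 < μ) (hℓ : 0 ≤ ℓ) {m : ℕ} {z : ℤ} (hz : z ≤ m)
    {a b : ℝ} (hb : 0 ≤ b) (h : μ * a ≤ socoRate μ ℓ ^ m * (ℓ / 2 * b)) :
    a ≤ socoC μ ℓ * (socoRate μ ℓ ^ z * b) := by
  rcases hℓ.eq_or_lt with rfl | hpos
  · rw [zero_div, zero_mul, mul_zero] at h
    rw [socoC, mul_zero, zero_div, zero_mul]
    exact nonpos_of_mul_nonpos_right h hμ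
  · have hz' : socoRate μ ℓ ^ m ≤ socoRate μ ℓ ^ z := by
      rw [← zpow_natCast]
      exact zpow_le_zpow_right_of_le_one₀ (socoRate_pos hμ hpos) (socoRate_le_one μ ℓ) hz
    have h0 : 0 ≤ socoRate μ ℓ ^ z * (ℓ * b) :=
      mul_nonneg (zpow_nonneg (socoRate_nonneg hμ hℓ) z) (by positivity)
    have h1 : μ * a ≤ socoRate μ ℓ ^ z * (ℓ / 2 * b) :=
      h.trans (mul_le_mul_of_nonneg_right hz' (by positivity))
    rw [socoC, div_mul_eq_mul_div, le_div_iff₀ hμ]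
    linarith

theorem theorem1 (n r p : ℕ) (μ ℓ : ℝ) (hμ : 0 < μ) (hℓ : 0 ≤ ℓ)
    (f : ℕ → Euc n → ℝ) (c : ℕ → SwitchDom n r → ℝ)
    (hf_convex : ∀ τ ∈ Finset.Ico 1 p, StrongConvexOn Set.univ μ (f τ))
    (hf_diff : ∀ τ ∈ Finset.Ico 1 p, ContDiff ℝ 2 (f τ))
    (hc_convex : ∀ τ ∈ Finset.Icc 1 p, ConvexOn ℝ Set.univ (c τ))
    (hc_smooth : ∀ τ ∈ Finset.Icc 1 p, StronglySmooth ℓ (c τ))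
    (hc_diff : ∀ τ ∈ Finset.Icc 1 p, ContDiff ℝ 2 (c τ)) :
    ∃ ψ : Euc n → (Fin p → Euc r) → Euc n → (Finset.Ico 1 p → Euc n),
      (∀ x0 w xp, socoArgmin p f c x0 w xp = {ψ x0 w xp}) ∧
      ∀ (x0 x0' : Euc n) (w w' : Fin p → Euc r) (xp xp' : Euc n) (h : Finset.Ico 1 p),
        ‖ψ x0 w xp h - ψ x0' w' xp' h‖ ≤
          socoC μ ℓ *
            (socoRate μ ℓ ^ ((h : ℤ) - 1) * ‖x0 - x0'‖ +
              ∑ τ : Fin p, socoRate μ ℓ ^ (|(h : ℤ) - (τ : ℤ)| - 1) * ‖w τ - w' τ‖ +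
              socoRate μ ℓ ^ ((p : ℤ) - (h : ℤ) - 1) * ‖xp - xp'‖) := by
  have hf : ∀ τ ∈ Finset.Ico 1 p, Differentiable ℝ (f τ) := fun τ hτ =>
    (hf_diff τ hτ).differentiable two_ne_zero
  have hc : ∀ τ ∈ Finset.Icc 1 p, Differentiable ℝ (c τ) := fun τ hτ =>
    (hc_diff τ hτ).differentiable two_ne_zero
  have hex : ∀ x0 w xp, ∃! y, ∀ z, socoCost p f c x0 w xp y ≤ socoCost p f c x0 w xp z :=
    fun x0 w xp => (strongConvexOn_socoCost hμ.le hf_convex hc_convex x0 w xp).existsUnique_forall_le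
      hμ (continuous_socoCost (fun τ hτ => (hf_diff τ hτ).continuous)
        (fun τ hτ => (hc_diff τ hτ).continuous) x0 w xp)
  choose ψ hψ hψu using hex
  refine ⟨ψ, fun x0 w xp => Set.eq_singleton_iff_unique_mem.2 ⟨hψ x0 w xp, hψu x0 w xp⟩, ?_⟩
  intro x0 x0' w w' xp xp' h
  obtain ⟨h1, hhp⟩ := Finset.mem_Ico.1 h.2
  have chain := fun (a a' : Euc n) (v v' : Fin p → Euc r) (b b' : Euc n) =>
    dissipativeChain_of_mem_argmin hℓ hf_convex hf hc_convex hc_smooth hc (hψ a v b) (hψ a' v' b')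
  have hleft : ‖ψ x0 w xp h - ψ x0' w xp h‖ ≤
      socoC μ ℓ * (socoRate μ ℓ ^ ((h : ℤ) - 1) * ‖x0 - x0'‖) := by
    have hb := (chain x0 x0' w w xp xp).le_of_left_endpoint hμ hℓ (fun j _ => by simp)
      (by simp only [socoTrajectory_last (by omega : p ≠ 0), sub_self]) h1 hhp
    simp only [socoTrajectory_coe, socoTrajectory_zero] at hb
    exact le_socoC_mul_zpow hμ hℓ (by omega) (norm_nonneg _) hb
  have hright : ‖ψ x0' w' xp h - ψ x0' w' xp' h‖ ≤
      socoC μ ℓ * (socoRate μ ℓ ^ ((p : ℤ) - (h : ℤ) - 1) * ‖xp - xp'‖) := by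
    have hb := (chain x0' x0' w' w' xp xp').le_of_right_endpoint hμ hℓ (fun j _ => by simp)
      (by simp only [socoTrajectory_zero, sub_self]) h1 hhp
    simp only [socoTrajectory_coe, socoTrajectory_last (by omega : p ≠ 0)] at hb
    exact le_socoC_mul_zpow hμ hℓ (by omega) (norm_nonneg _) hb
  have hinput : ‖ψ x0' w xp h - ψ x0' w' xp h‖ ≤ ∑ τ : Fin p,
      socoC μ ℓ * socoRate μ ℓ ^ (|(h : ℤ) - (τ : ℤ)| - 1) * ‖w τ - w' τ‖ := by
    refine norm_sub_le_sum_of_update (F := fun w => ψ x0' w xp h) (fun v i a => ?_) w w'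
    obtain ⟨hR, hL⟩ := (chain x0' x0' v (Function.update v i a) xp xp).le_of_source hμ hℓ i.2
      (fun j hj hji => by
        simp only [dif_pos hj]
        rw [Function.update_of_ne (fun hc => hji (congrArg Fin.val hc)), sub_self, norm_zero,
          mul_zero])
      (by positivity) (by simp only [socoTrajectory_zero, sub_self])
      (by simp only [socoTrajectory_last (by omega : p ≠ 0), sub_self]) h1 hhp
    simp only [socoTrajectory_coe, dif_pos i.2, Fin.eta, Function.update_self] at hR hL
    rw [mul_assoc]
    rcases lt_or_ge (i : ℕ) h with hih | hih
    · refine le_socoC_mul_zpow hμ hℓ ?_ (norm_nonneg _) (hR hih)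
      rw [abs_of_nonneg (by omega)]
      omega
    · -- Left of the perturbed edge the decay exceeds the bound by one power of the rate.
      refine le_socoC_mul_zpow hμ hℓ ?_ (norm_nonneg _) (hL hih)
      rw [abs_of_nonpos (by omega)]
      omega
  simp only [mul_assoc, ← Finset.mul_sum] at hinput
  have htri := norm_sub_le_norm_sub_add_norm_sub (ψ x0 w xp h) (ψ x0' w xp h) (ψ x0' w' xp' h)
  have htri' := norm_sub_le_norm_sub_add_norm_sub (ψ x0' w xp h) (ψ x0' w' xp h) (ψ x0' w' xp' h)
  linarith
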